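/- Let $R$ be an associative ring with unit, not necessarily commutative. An $R$-algebra is a ring $S$ together with a ring homomorphism $R\to S$ (whose image need not be central). A functor of (left) $\mathcal R$-modules is a covariant functor $\mathbb M$ from $R$-algebras to abelian groups together with a left $S$-module structure on $\mathbb M(S)$ for every $R$-algebra $S$, such that $\mathbb M(w)(s\cdot m)=w(s)\cdot \mathbb M(w)(m)$ for every morphism $w\colon S\to S'$, $s\in S$, $m\in\mathbb M(S)$; a morphism of such functors is a natural transformation that is $S$-linear at every $R$-algebra $S$, and $\mathrm{Hom}_{\mathcal R}$ denotes the abelian group of these morphisms. Functors of right $\mathcal R$-modules and their morphisms are defined likewise. A left $R$-module $M$ defines the quasi-coherent functor of left $\mathcal R$-modules $\mathcal M(S)=S\otimes_R M$, and a right $R$-module $N$ the quasi-coherent functor of right $\mathcal R$-modules $\mathcal N(S)=N\otimes_R S$. The dual of a functor of left $\mathcal R$-modules $\mathbb M$ is the functor of right $\mathcal R$-modules $\mathbb M^\vee(S)=\mathrm{Hom}_{\mathcal R}(\mathbb M,\mathcal S)$, where $\mathcal S(T)=T\otimes_R S$ and $S$ acts by right multiplication on the factor $S$. The dual of a functor of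 right $\mathcal R$-modules $\mathbb N$ is the functor of left $\mathcal R$-modules $\mathbb N^\vee(S)=\mathrm{Hom}_{\mathcal R}(\mathbb N,\mathcal S)$, where now $\mathcal S(T)=S\otimes_R T$ and $S$ acts by left multiplication on the factor $S$. Theorem. Let $M$ be a left $R$-module. The natural morphism of functors of $\mathcal R$-modules $$\mathcal M\longrightarrow \mathcal M^{\vee\vee},$$ which sends $x\in\mathcal M(S)$ to the morphism $\mathcal M^\vee\to\mathcal S$ given at an $R$-algebra $T$ by $\mathrm{Hom}_{\mathcal R}(\mathcal M,\mathcal T)\ni f\mapsto f_S(x)\in \mathcal T(S)=S\otimes_R T=\mathcal S(T)$, is an isomorphism. -/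

import Mathlib

open CategoryTheory TensorProduct MulOpposite

universe u v w u₁

noncomputable section

namespace RMod

/-! ## Tensor product of a right module and a left module over a noncommutative ring -/

section Tensor

variable (R : Type u) [Ring R]
variable (N : Type v) [AddCommGroup N] [Module Rᵐᵒᵖ N]
variable (M : Type w) [AddCommGroup M] [Module R M]

/-- The subgroup of `N ⊗_ℤ M` generated by the elements `n r ⊗ m - n ⊗ r m`. -/
def tensorRel : AddSubgroup (N ⊗[ℤ] M) :=
  AddSubgroup.closure
    {z | ∃ (n : N) (r : R) (m : M), z = (op r • n) ⊗ₜ[ℤ] m - n ⊗ₜ[ℤ] (r • m)}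

/-- The abelian group `N ⊗_R M`, for a right `R`-module `N` (that is, a left module over the
opposite ring) and a left `R`-module `M`. -/
def Tensor : Type (max v w) := (N ⊗[ℤ] M) ⧸ tensorRel R N M

instance : AddCommGroup (Tensor R N M) :=
  inferInstanceAs (AddCommGroup ((N ⊗[ℤ] M) ⧸ tensorRel R N M))

/-- The quotient map `N ⊗_ℤ M → N ⊗_R M`. -/
def Tensor.mk : (N ⊗[ℤ] M) →+ Tensor R N M := QuotientAddGroup.mk' (tensorRel R N M)

variable {N M}

/-- The class of `n ⊗ m` in `N ⊗_R M`. -/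
def tmul (n : N) (m : M) : Tensor R N M :=
  Tensor.mk R N M (n ⊗ₜ[ℤ] m)

variable {R}

lemma tmul_add (n : N) (m m' : M) : tmul R n (m + m') = tmul R n m + tmul R n m' := by
  simp only [tmul, TensorProduct.tmul_add, map_add]

lemma add_tmul (n n' : N) (m : M) : tmul R (n + n') m = tmul R n m + tmul R n' m := by
  simp only [tmul, TensorProduct.add_tmul, map_add]

lemma smul_tmul (n : N) (r : R) (m : M) : tmul R (op r • n) m = tmul R n (r • m) := by
  have h : (op r • n) ⊗ₜ[ℤ] m - n ⊗ₜ[ℤ] (r • m) ∈ tensorRel R N M :=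
    AddSubgroup.subset_closure ⟨n, r, m, rfl⟩
  have h' := (QuotientAddGroup.eq_zero_iff _).mpr h
  exact sub_eq_zero.mp h'

lemma Tensor.induction {p : Tensor R N M → Prop} (h0 : p 0) (ht : ∀ n m, p (tmul R n m))
    (ha : ∀ x y, p x → p y → p (x + y)) (x : Tensor R N M) : p x := by
  obtain ⟨z, rfl⟩ := QuotientAddGroup.mk'_surjective (tensorRel R N M) x
  induction z with
  | zero => exact h0
  | tmul n m => exact ht n m
  | add a b iha ihb => exact ha _ _ iha ihb

lemma Tensor.hom_ext {A : Type*} [AddCommGroup A] {f g : Tensor R N M →+ A}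
    (h : ∀ n m, f (tmul R n m) = g (tmul R n m)) : f = g := by
  ext x
  induction x using Tensor.induction with
  | h0 => simp
  | ht n m => exact h n m
  | ha x y hx hy => simp [hx, hy]

variable {N' : Type*} [AddCommGroup N'] [Module Rᵐᵒᵖ N']
variable {M' : Type*} [AddCommGroup M'] [Module R M']

/-- The homomorphism `f ⊗ g : N ⊗_R M → N' ⊗_R M'`. -/
def Tensor.map (f : N →ₗ[Rᵐᵒᵖ] N') (g : M →ₗ[R] M') : Tensor R N M →+ Tensor R N' M' :=
  QuotientAddGroup.lift (tensorRel R N M)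
    ((Tensor.mk R N' M').comp
      (TensorProduct.map f.toAddMonoidHom.toIntLinearMap
        g.toAddMonoidHom.toIntLinearMap).toAddMonoidHom)
    (by
      rw [tensorRel, AddSubgroup.closure_le]
      rintro _ ⟨n, r, m, rfl⟩
      have h := sub_eq_zero.mpr (smul_tmul (R := R) (f n) r (g m))
      rw [← map_smul f, ← map_smul g] at h
      change _ = _
      rw [map_sub]
      exact h)

@[simp] lemma Tensor.map_tmul (f : N →ₗ[Rᵐᵒᵖ] N') (g : M →ₗ[R] M') (n : N) (m : M) :
    Tensor.map f g (tmul R n m) = tmul R (f n) (g m) := rfl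

lemma Tensor.map_id_id (x : Tensor R N M) :
    Tensor.map (LinearMap.id : N →ₗ[Rᵐᵒᵖ] N) (LinearMap.id : M →ₗ[R] M) x = x := by
  have : Tensor.map (LinearMap.id : N →ₗ[Rᵐᵒᵖ] N) (LinearMap.id : M →ₗ[R] M) =
      AddMonoidHom.id _ := Tensor.hom_ext fun n m => rfl
  rw [this]; rfl

lemma Tensor.map_map {N'' : Type*} [AddCommGroup N''] [Module Rᵐᵒᵖ N'']
    {M'' : Type*} [AddCommGroup M''] [Module R M'']
    (f' : N' →ₗ[Rᵐᵒᵖ] N'') (g' : M' →ₗ[R] M'') (f : N →ₗ[Rᵐᵒᵖ] N') (g : M →ₗ[R] M')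
    (x : Tensor R N M) :
    Tensor.map f' g' (Tensor.map f g x) = Tensor.map (f' ∘ₗ f) (g' ∘ₗ g) x := by
  have : (Tensor.map f' g').comp (Tensor.map f g) = Tensor.map (f' ∘ₗ f) (g' ∘ₗ g) :=
    Tensor.hom_ext fun n m => rfl
  exact DFunLike.congr_fun this x

lemma Tensor.map_map_eq {N'' : Type*} [AddCommGroup N''] [Module Rᵐᵒᵖ N'']
    {M'' : Type*} [AddCommGroup M''] [Module R M'']
    {P : Type*} [AddCommGroup P] [Module Rᵐᵒᵖ P] {Q : Type*} [AddCommGroup Q] [Module R Q]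
    {f' : N' →ₗ[Rᵐᵒᵖ] N''} {g' : M' →ₗ[R] M''} {f : N →ₗ[Rᵐᵒᵖ] N'} {g : M →ₗ[R] M'}
    {k' : P →ₗ[Rᵐᵒᵖ] N''} {l' : Q →ₗ[R] M''} {k : N →ₗ[Rᵐᵒᵖ] P} {l : M →ₗ[R] Q}
    (hf : ∀ n, f' (f n) = k' (k n)) (hg : ∀ m, g' (g m) = l' (l m)) (x : Tensor R N M) :
    Tensor.map f' g' (Tensor.map f g x) = Tensor.map k' l' (Tensor.map k l x) := by
  have : (Tensor.map f' g').comp (Tensor.map f g) = (Tensor.map k' l').comp (Tensor.map k l) :=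
    Tensor.hom_ext fun n m => by simp [hf, hg]
  exact DFunLike.congr_fun this x

lemma Tensor.map_add_left (f f' : N →ₗ[Rᵐᵒᵖ] N') (g : M →ₗ[R] M') (x : Tensor R N M) :
    Tensor.map (f + f') g x = Tensor.map f g x + Tensor.map f' g x := by
  have : Tensor.map (f + f') g = Tensor.map f g + Tensor.map f' g :=
    Tensor.hom_ext fun n m => add_tmul _ _ _
  rw [this]; rfl

lemma Tensor.map_add_right (f : N →ₗ[Rᵐᵒᵖ] N') (g g' : M →ₗ[R] M') (x : Tensor R N M) :
    Tensor.map f (g + g') x = Tensor.map f g x + Tensor.map f g' x := by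
  have : Tensor.map f (g + g') = Tensor.map f g + Tensor.map f g' :=
    Tensor.hom_ext fun n m => tmul_add _ _ _
  rw [this]; rfl

lemma Tensor.map_zero_left (g : M →ₗ[R] M') (x : Tensor R N M) :
    Tensor.map (0 : N →ₗ[Rᵐᵒᵖ] N') g x = 0 := by
  have h := Tensor.map_add_left (0 : N →ₗ[Rᵐᵒᵖ] N') 0 g x
  rwa [add_zero, left_eq_add] at h

lemma Tensor.map_zero_right (f : N →ₗ[Rᵐᵒᵖ] N') (x : Tensor R N M) :
    Tensor.map f (0 : M →ₗ[R] M') x = 0 := by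
  have h := Tensor.map_add_right f (0 : M →ₗ[R] M') 0 x
  rwa [add_zero, left_eq_add] at h

/-- If `N` is an `(A, R)`-bimodule, then `N ⊗_R M` is a left `A`-module: `a (n ⊗ m) = a n ⊗ m`. -/
abbrev Tensor.leftModule (A : Type*) [Ring A] [Module A N] [SMulCommClass A Rᵐᵒᵖ N] :
    Module A (Tensor R N M) where
  smul a x := Tensor.map (Module.toModuleEnd Rᵐᵒᵖ N a) LinearMap.id x
  one_smul x := by
    change Tensor.map (Module.toModuleEnd Rᵐᵒᵖ N (1 : A)) LinearMap.id x = x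
    rw [map_one]; exact Tensor.map_id_id x
  mul_smul a b x := by
    change Tensor.map (Module.toModuleEnd Rᵐᵒᵖ N (a * b)) LinearMap.id x =
      Tensor.map _ _ (Tensor.map _ _ x)
    rw [map_mul, Tensor.map_map]; rfl
  smul_zero a := map_zero _
  smul_add a := map_add _
  add_smul a b x := by
    change Tensor.map (Module.toModuleEnd Rᵐᵒᵖ N (a + b)) LinearMap.id x =
      Tensor.map _ _ x + Tensor.map _ _ x
    rw [map_add, Tensor.map_add_left]
  zero_smul x := by
    change Tensor.map (Module.toModuleEnd Rᵐᵒᵖ N (0 : A)) LinearMap.id x = 0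
    rw [map_zero]; exact Tensor.map_zero_left _ x

/-- If `M` is an `(R, B)`-bimodule, then `N ⊗_R M` is a right `B`-module: `(n ⊗ m) b = n ⊗ m b`. -/
abbrev Tensor.rightModule (B : Type*) [Ring B] [Module Bᵐᵒᵖ M] [SMulCommClass Bᵐᵒᵖ R M] :
    Module Bᵐᵒᵖ (Tensor R N M) where
  smul b x := Tensor.map LinearMap.id (Module.toModuleEnd R M b) x
  one_smul x := by
    change Tensor.map LinearMap.id (Module.toModuleEnd R M (1 : Bᵐᵒᵖ)) x = x
    rw [map_one]; exact Tensor.map_id_id x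
  mul_smul a b x := by
    change Tensor.map LinearMap.id (Module.toModuleEnd R M (a * b)) x =
      Tensor.map _ _ (Tensor.map _ _ x)
    rw [map_mul, Tensor.map_map]; rfl
  smul_zero a := map_zero _
  smul_add a := map_add _
  add_smul a b x := by
    change Tensor.map LinearMap.id (Module.toModuleEnd R M (a + b)) x =
      Tensor.map _ _ x + Tensor.map _ _ x
    rw [map_add, Tensor.map_add_right]
  zero_smul x := by
    change Tensor.map LinearMap.id (Module.toModuleEnd R M (0 : Bᵐᵒᵖ)) x = 0
    rw [map_zero]; exact Tensor.map_zero_right _ x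

end Tensor

/-! ## `R`-algebras -/

/-- The category of `R`-algebras: rings `S` with a ring homomorphism `R → S` whose image need not be
central. The underlying ring of `S : RAlg R` is `S.right`. -/
abbrev RAlg (R : Type u) [Ring R] := Under (RingCat.of R)

section RAlg

variable {R : Type u} [Ring R]

/-- The structure homomorphism `R → S`. -/
def RAlg.str (S : RAlg R) : R →+* S.right := RingCat.Hom.hom (S := S.right) S.hom

lemma RAlg.map_str {S T : RAlg R} (f : S ⟶ T) (r : R) : f.right (S.str r) = T.str r :=
  DFunLike.congr_fun (congrArg RingCat.Hom.hom (Under.w f)) r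

/-- An `R`-algebra `S` as a left `R`-module. -/
instance RAlg.leftModule (S : RAlg R) : Module R S.right := Module.compHom _ S.str

/-- An `R`-algebra `S` as a right `R`-module. -/
instance RAlg.rightModule (S : RAlg R) : Module Rᵐᵒᵖ S.right := Module.compHom _ S.str.op

lemma RAlg.smul_def (S : RAlg R) (r : R) (s : S.right) : r • s = S.str r * s := rfl

lemma RAlg.op_smul_def (S : RAlg R) (r : R) (s : S.right) : op r • s = s * S.str r := rfl

instance (S : RAlg R) : SMulCommClass S.right Rᵐᵒᵖ S.right where
  smul_comm s r t := by
    induction r using MulOpposite.rec' with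
    | h r => simp only [RAlg.op_smul_def, smul_eq_mul, mul_assoc]

instance (S : RAlg R) : SMulCommClass S.rightᵐᵒᵖ R S.right where
  smul_comm s r t := by
    simp only [RAlg.smul_def, MulOpposite.smul_eq_mul_unop, mul_assoc]

/-- A morphism of `R`-algebras as a morphism of left `R`-modules. -/
def RAlg.leftLinear {S T : RAlg R} (f : S ⟶ T) : S.right →ₗ[R] T.right where
  toFun := f.right
  map_add' := map_add f.right.hom
  map_smul' r s := by
    simp only [RAlg.smul_def, RingHom.id_apply]
    rw [← RAlg.map_str f]; exact map_mul f.right.hom _ _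

/-- A morphism of `R`-algebras as a morphism of right `R`-modules. -/
def RAlg.rightLinear {S T : RAlg R} (f : S ⟶ T) : S.right →ₗ[Rᵐᵒᵖ] T.right where
  toFun := f.right
  map_add' := map_add f.right.hom
  map_smul' r s := by
    induction r using MulOpposite.rec' with
    | h r =>
      simp only [RAlg.op_smul_def, RingHom.id_apply]
      rw [← RAlg.map_str f]; exact map_mul f.right.hom _ _

end RAlg

/-! ## Functors of left and right modules over the functor `S ↦ S` -/

/-- A functor of (left) modules: a functor `F` from `R`-algebras to abelian groups together with a
left `S`-module structure on each `F(S)`, functorially in `S`. -/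
structure LeftFunctor (R : Type u) [Ring R] where
  functor : RAlg R ⥤ AddCommGrpCat.{v}
  module : ∀ S : RAlg R, Module S.right (functor.obj S)
  map_smul : ∀ {S T : RAlg R} (f : S ⟶ T) (s : S.right) (x : functor.obj S),
    functor.map f (s • x) = f.right s • functor.map f x

/-- A functor of right modules: as above, with a right `S`-module structure on each `F(S)`. -/
structure RightFunctor (R : Type u) [Ring R] where
  functor : RAlg R ⥤ AddCommGrpCat.{v}
  module : ∀ S : RAlg R, Module S.rightᵐᵒᵖ (functor.obj S)
  map_smul : ∀ {S T : RAlg R} (f : S ⟶ T) (s : S.right) (x : functor.obj S),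
    functor.map f (op s • x) = op (f.right s) • functor.map f x

attribute [instance] LeftFunctor.module RightFunctor.module

/-- Morphisms of functors of left modules: natural transformations that are `S`-linear at each
`R`-algebra `S`. (The two functors may take values in different universes.) -/
@[ext] structure LeftFunctor.Hom {R : Type u} [Ring R]
    (F : LeftFunctor.{u, v} R) (G : LeftFunctor.{u, w} R) where
  app : ∀ S : RAlg R, F.functor.obj S →ₗ[S.right] G.functor.obj S
  naturality : ∀ {S T : RAlg R} (f : S ⟶ T) (x : F.functor.obj S),
    app T (F.functor.map f x) = G.functor.map f (app S x)

/-- Morphisms of functors of right modules. -/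
@[ext] structure RightFunctor.Hom {R : Type u} [Ring R]
    (F : RightFunctor.{u, v} R) (G : RightFunctor.{u, w} R) where
  app : ∀ S : RAlg R, F.functor.obj S →ₗ[S.rightᵐᵒᵖ] G.functor.obj S
  naturality : ∀ {S T : RAlg R} (f : S ⟶ T) (x : F.functor.obj S),
    app T (F.functor.map f x) = G.functor.map f (app S x)

section Hom

variable {R : Type u} [Ring R]

namespace LeftFunctor.Hom

variable {F : LeftFunctor.{u, v} R} {G : LeftFunctor.{u, w} R}

lemma app_injective : Function.Injective (Hom.app : Hom F G → _) := fun _ _ h => Hom.ext h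

instance : Zero (Hom F G) := ⟨⟨fun _ => 0, fun f x => by simp⟩⟩
instance : Add (Hom F G) :=
  ⟨fun a b => ⟨fun S => a.app S + b.app S, fun f x => by simp [a.naturality, b.naturality]⟩⟩
instance : Neg (Hom F G) := ⟨fun a => ⟨fun S => -a.app S, fun f x => by simp [a.naturality]⟩⟩
instance : Sub (Hom F G) :=
  ⟨fun a b => ⟨fun S => a.app S - b.app S, fun f x => by simp [a.naturality, b.naturality]⟩⟩
instance : SMul ℕ (Hom F G) :=
  ⟨fun n a => ⟨fun S => n • a.app S, fun f x => by simp [a.naturality]⟩⟩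
instance : SMul ℤ (Hom F G) :=
  ⟨fun n a => ⟨fun S => n • a.app S, fun f x => by simp [a.naturality]⟩⟩

/-- Morphisms are added componentwise. -/
instance : AddCommGroup (Hom F G) :=
  app_injective.addCommGroup _ rfl (fun _ _ => rfl) (fun _ => rfl) (fun _ _ => rfl)
    (fun _ _ => rfl) (fun _ _ => rfl)

/-- The identity morphism. -/
def id (F : LeftFunctor.{u, v} R) : Hom F F := ⟨fun _ => LinearMap.id, fun _ _ => rfl⟩

/-- The composite `b ∘ a`. -/
def comp {H : LeftFunctor.{u, u₁} R} (b : Hom G H) (a : Hom F G) : Hom F H :=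
  ⟨fun S => b.app S ∘ₗ a.app S, fun f x => by simp [a.naturality, b.naturality]⟩

/-- A morphism is an isomorphism if it has a two-sided inverse morphism. -/
def IsIso (a : Hom F G) : Prop := ∃ b : Hom G F, b.comp a = id F ∧ a.comp b = id G

lemma comp_zero {H : LeftFunctor.{u, u₁} R} (b : Hom G H) : b.comp (0 : Hom F G) = 0 :=
  Hom.ext (funext fun S => LinearMap.ext fun _ => map_zero (b.app S))

lemma comp_add {H : LeftFunctor.{u, u₁} R} (b : Hom G H) (a a' : Hom F G) :
    b.comp (a + a') = b.comp a + b.comp a' :=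
  Hom.ext (funext fun S => LinearMap.ext fun x => map_add (b.app S) (a.app S x) (a'.app S x))

end LeftFunctor.Hom

namespace RightFunctor.Hom

variable {F : RightFunctor.{u, v} R} {G : RightFunctor.{u, w} R}

lemma app_injective : Function.Injective (Hom.app : Hom F G → _) := fun _ _ h => Hom.ext h

instance : Zero (Hom F G) := ⟨⟨fun _ => 0, fun f x => by simp⟩⟩
instance : Add (Hom F G) :=
  ⟨fun a b => ⟨fun S => a.app S + b.app S, fun f x => by simp [a.naturality, b.naturality]⟩⟩
instance : Neg (Hom F G) := ⟨fun a => ⟨fun S => -a.app S, fun f x => by simp [a.naturality]⟩⟩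
instance : Sub (Hom F G) :=
  ⟨fun a b => ⟨fun S => a.app S - b.app S, fun f x => by simp [a.naturality, b.naturality]⟩⟩
instance : SMul ℕ (Hom F G) :=
  ⟨fun n a => ⟨fun S => n • a.app S, fun f x => by simp [a.naturality]⟩⟩
instance : SMul ℤ (Hom F G) :=
  ⟨fun n a => ⟨fun S => n • a.app S, fun f x => by simp [a.naturality]⟩⟩

/-- Morphisms are added componentwise. -/
instance : AddCommGroup (Hom F G) :=
  app_injective.addCommGroup _ rfl (fun _ _ => rfl) (fun _ => rfl) (fun _ _ => rfl)
    (fun _ _ => rfl) (fun _ _ => rfl)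

/-- The composite `b ∘ a`. -/
def comp {H : RightFunctor.{u, u₁} R} (b : Hom G H) (a : Hom F G) : Hom F H :=
  ⟨fun S => b.app S ∘ₗ a.app S, fun f x => by simp [a.naturality, b.naturality]⟩

lemma comp_zero {H : RightFunctor.{u, u₁} R} (b : Hom G H) : b.comp (0 : Hom F G) = 0 :=
  Hom.ext (funext fun S => LinearMap.ext fun _ => map_zero (b.app S))

lemma comp_add {H : RightFunctor.{u, u₁} R} (b : Hom G H) (a a' : Hom F G) :
    b.comp (a + a') = b.comp a + b.comp a' :=
  Hom.ext (funext fun S => LinearMap.ext fun x => map_add (b.app S) (a.app S x) (a'.app S x))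

end RightFunctor.Hom

end Hom

/-! ## Quasi-coherent functors -/

section QuasiCoherent

variable (R : Type u) [Ring R]

/-- The quasi-coherent functor `S ↦ S ⊗_R M` of a left `R`-module `M`. -/
def qcLeft (M : Type v) [AddCommGroup M] [Module R M] : LeftFunctor.{u, max u v} R where
  functor :=
    { obj := fun S => AddCommGrpCat.of (Tensor R S.right M)
      map := fun f => AddCommGrpCat.ofHom (Tensor.map (RAlg.rightLinear f) LinearMap.id)
      map_id := fun _ => AddCommGrpCat.hom_ext (AddMonoidHom.ext fun x => Tensor.map_id_id x)
      map_comp := fun _ _ => AddCommGrpCat.hom_ext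
        (Tensor.hom_ext fun _ _ => rfl) }
  module S := Tensor.leftModule S.right
  map_smul f s x :=
    Tensor.map_map_eq (fun t => map_mul f.right.hom s t) (by intro; rfl) x

/-- The quasi-coherent functor `S ↦ N ⊗_R S` of a right `R`-module `N`. -/
def qcRight (N : Type v) [AddCommGroup N] [Module Rᵐᵒᵖ N] : RightFunctor.{u, max u v} R where
  functor :=
    { obj := fun S => AddCommGrpCat.of (Tensor R N S.right)
      map := fun f => AddCommGrpCat.ofHom (Tensor.map LinearMap.id (RAlg.leftLinear f))
      map_id := fun _ => AddCommGrpCat.hom_ext (AddMonoidHom.ext fun x => Tensor.map_id_id x)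
      map_comp := fun _ _ => AddCommGrpCat.hom_ext
        (Tensor.hom_ext fun _ _ => rfl) }
  module S := Tensor.rightModule S.right
  map_smul f s x :=
    Tensor.map_map_eq (by intro; rfl) (fun t => map_mul f.right.hom t s) x

variable {R}

/-- The morphism of quasi-coherent functors induced by a morphism of left modules. -/
def qcLeftMap {M M' : Type v} [AddCommGroup M] [Module R M] [AddCommGroup M'] [Module R M']
    (g : M →ₗ[R] M') : LeftFunctor.Hom (qcLeft R M) (qcLeft R M') where
  app S :=
    { toFun := Tensor.map LinearMap.id g
      map_add' := map_add _
      map_smul' := fun _ x => Tensor.map_map_eq (by intro; rfl) (by intro; rfl) x }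
  naturality _ x := by
    change Tensor.map _ _ (Tensor.map _ _ x) = Tensor.map _ _ (Tensor.map _ _ x)
    exact Tensor.map_map_eq (by intro; rfl) (by intro; rfl) x

/-- The morphism of quasi-coherent functors induced by a morphism of right modules. -/
def qcRightMap {N N' : Type v} [AddCommGroup N] [Module Rᵐᵒᵖ N] [AddCommGroup N'] [Module Rᵐᵒᵖ N']
    (g : N →ₗ[Rᵐᵒᵖ] N') : RightFunctor.Hom (qcRight R N) (qcRight R N') where
  app S :=
    { toFun := Tensor.map g LinearMap.id
      map_add' := map_add _
      map_smul' := fun _ x => Tensor.map_map_eq (by intro; rfl) (by intro; rfl) x }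
  naturality _ x := by
    change Tensor.map _ _ (Tensor.map _ _ x) = Tensor.map _ _ (Tensor.map _ _ x)
    exact Tensor.map_map_eq (by intro; rfl) (by intro; rfl) x

lemma qcLeftMap_id_comp {F : LeftFunctor.{u, w} R} {M : Type v} [AddCommGroup M] [Module R M]
    (a : LeftFunctor.Hom F (qcLeft R M)) : (qcLeftMap (LinearMap.id : M →ₗ[R] M)).comp a = a :=
  LeftFunctor.Hom.ext (funext fun S => LinearMap.ext fun x => Tensor.map_id_id (a.app S x))

lemma qcLeftMap_comp_comp {F : LeftFunctor.{u, w} R} {M M' M'' : Type v} [AddCommGroup M] [Module R M]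
    [AddCommGroup M'] [Module R M'] [AddCommGroup M''] [Module R M''] (g' : M' →ₗ[R] M'')
    (g : M →ₗ[R] M') (a : LeftFunctor.Hom F (qcLeft R M)) :
    (qcLeftMap (g' ∘ₗ g)).comp a = (qcLeftMap g').comp ((qcLeftMap g).comp a) :=
  LeftFunctor.Hom.ext (funext fun S => LinearMap.ext fun x =>
    (Tensor.map_map LinearMap.id g' LinearMap.id g (a.app S x)).symm)

lemma qcLeftMap_add_comp {F : LeftFunctor.{u, w} R} {M M' : Type v} [AddCommGroup M] [Module R M]
    [AddCommGroup M'] [Module R M'] (g g' : M →ₗ[R] M') (a : LeftFunctor.Hom F (qcLeft R M)) :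
    (qcLeftMap (g + g')).comp a = (qcLeftMap g).comp a + (qcLeftMap g').comp a :=
  LeftFunctor.Hom.ext (funext fun S => LinearMap.ext fun x => Tensor.map_add_right LinearMap.id g g' (a.app S x))

lemma qcLeftMap_zero_comp {F : LeftFunctor.{u, w} R} {M M' : Type v} [AddCommGroup M] [Module R M]
    [AddCommGroup M'] [Module R M'] (a : LeftFunctor.Hom F (qcLeft R M)) :
    (qcLeftMap (0 : M →ₗ[R] M')).comp a = 0 :=
  LeftFunctor.Hom.ext (funext fun S => LinearMap.ext fun x => Tensor.map_zero_right LinearMap.id (a.app S x))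

lemma qcRightMap_id_comp {G : RightFunctor.{u, w} R} {N : Type v} [AddCommGroup N] [Module Rᵐᵒᵖ N]
    (a : RightFunctor.Hom G (qcRight R N)) : (qcRightMap (LinearMap.id : N →ₗ[Rᵐᵒᵖ] N)).comp a = a :=
  RightFunctor.Hom.ext (funext fun S => LinearMap.ext fun x => Tensor.map_id_id (a.app S x))

lemma qcRightMap_comp_comp {G : RightFunctor.{u, w} R} {N N' N'' : Type v} [AddCommGroup N] [Module Rᵐᵒᵖ N]
    [AddCommGroup N'] [Module Rᵐᵒᵖ N'] [AddCommGroup N''] [Module Rᵐᵒᵖ N''] (g' : N' →ₗ[Rᵐᵒᵖ] N'')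
    (g : N →ₗ[Rᵐᵒᵖ] N') (a : RightFunctor.Hom G (qcRight R N)) :
    (qcRightMap (g' ∘ₗ g)).comp a = (qcRightMap g').comp ((qcRightMap g).comp a) :=
  RightFunctor.Hom.ext (funext fun S => LinearMap.ext fun x =>
    (Tensor.map_map g' LinearMap.id g LinearMap.id (a.app S x)).symm)

lemma qcRightMap_add_comp {G : RightFunctor.{u, w} R} {N N' : Type v} [AddCommGroup N] [Module Rᵐᵒᵖ N]
    [AddCommGroup N'] [Module Rᵐᵒᵖ N'] (g g' : N →ₗ[Rᵐᵒᵖ] N') (a : RightFunctor.Hom G (qcRight R N)) :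
    (qcRightMap (g + g')).comp a = (qcRightMap g).comp a + (qcRightMap g').comp a :=
  RightFunctor.Hom.ext (funext fun S => LinearMap.ext fun x => Tensor.map_add_left g g' LinearMap.id (a.app S x))

lemma qcRightMap_zero_comp {G : RightFunctor.{u, w} R} {N N' : Type v} [AddCommGroup N] [Module Rᵐᵒᵖ N]
    [AddCommGroup N'] [Module Rᵐᵒᵖ N'] (a : RightFunctor.Hom G (qcRight R N)) :
    (qcRightMap (0 : N →ₗ[Rᵐᵒᵖ] N')).comp a = 0 :=
  RightFunctor.Hom.ext (funext fun S => LinearMap.ext fun x => Tensor.map_zero_left LinearMap.id (a.app S x))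

end QuasiCoherent

/-! ## Duals and the biduality morphism -/

section Dual

variable {R : Type u} [Ring R]

/-- The right `S`-module structure of `Hom(F, 𝒮)`, where `𝒮(T) = T ⊗_R S`, induced by right
multiplication on `S`. -/
instance LeftFunctor.Hom.instModule (F : LeftFunctor.{u, v} R) (S : RAlg R) :
    Module S.rightᵐᵒᵖ (LeftFunctor.Hom F (qcLeft R S.right)) where
  smul s a := (qcLeftMap (Module.toModuleEnd R S.right s)).comp a
  one_smul a := by
    change (qcLeftMap (Module.toModuleEnd R S.right (1 : S.rightᵐᵒᵖ))).comp a = a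
    rw [map_one]; exact qcLeftMap_id_comp a
  mul_smul s t a := by
    change (qcLeftMap (Module.toModuleEnd R S.right (s * t))).comp a = _
    rw [map_mul]; exact qcLeftMap_comp_comp _ _ a
  smul_zero s := LeftFunctor.Hom.comp_zero _
  smul_add s a b := LeftFunctor.Hom.comp_add _ a b
  add_smul s t a := by
    change (qcLeftMap (Module.toModuleEnd R S.right (s + t))).comp a = _
    rw [map_add]; exact qcLeftMap_add_comp _ _ a
  zero_smul a := by
    change (qcLeftMap (Module.toModuleEnd R S.right (0 : S.rightᵐᵒᵖ))).comp a = 0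
    rw [map_zero]; exact qcLeftMap_zero_comp a

/-- The left `S`-module structure of `Hom(G, 𝒮)`, where `𝒮(T) = S ⊗_R T`, induced by left
multiplication on `S`. -/
instance RightFunctor.Hom.instModule (G : RightFunctor.{u, v} R) (S : RAlg R) :
    Module S.right (RightFunctor.Hom G (qcRight R S.right)) where
  smul s a := (qcRightMap (Module.toModuleEnd Rᵐᵒᵖ S.right s)).comp a
  one_smul a := by
    change (qcRightMap (Module.toModuleEnd Rᵐᵒᵖ S.right (1 : S.right))).comp a = a
    rw [map_one]; exact qcRightMap_id_comp a
  mul_smul s t a := by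
    change (qcRightMap (Module.toModuleEnd Rᵐᵒᵖ S.right (s * t))).comp a = _
    rw [map_mul]; exact qcRightMap_comp_comp _ _ a
  smul_zero s := RightFunctor.Hom.comp_zero _
  smul_add s a b := RightFunctor.Hom.comp_add _ a b
  add_smul s t a := by
    change (qcRightMap (Module.toModuleEnd Rᵐᵒᵖ S.right (s + t))).comp a = _
    rw [map_add]; exact qcRightMap_add_comp _ _ a
  zero_smul a := by
    change (qcRightMap (Module.toModuleEnd Rᵐᵒᵖ S.right (0 : S.right))).comp a = 0
    rw [map_zero]; exact qcRightMap_zero_comp a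

/-- The dual `S ↦ Hom(F, 𝒮)` of a functor of left modules, a functor of right modules; here `𝒮` is
the quasi-coherent functor `T ↦ T ⊗_R S` of the left `R`-module `S`. -/
def LeftFunctor.dual (F : LeftFunctor.{u, v} R) : RightFunctor.{u, max (u + 1) v} R where
  functor :=
    { obj := fun S => AddCommGrpCat.of (LeftFunctor.Hom F (qcLeft R S.right))
      map := fun f => AddCommGrpCat.ofHom
        { toFun := fun a => (qcLeftMap (RAlg.leftLinear f)).comp a
          map_zero' := LeftFunctor.Hom.comp_zero _
          map_add' := LeftFunctor.Hom.comp_add _ }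
      map_id := fun _ => AddCommGrpCat.hom_ext (AddMonoidHom.ext fun a => qcLeftMap_id_comp a)
      map_comp := fun f g => AddCommGrpCat.hom_ext (AddMonoidHom.ext fun a =>
        qcLeftMap_comp_comp (RAlg.leftLinear g) (RAlg.leftLinear f) a) }
  module S := LeftFunctor.Hom.instModule F S
  map_smul {S T} f s a := by
    change (qcLeftMap (RAlg.leftLinear f)).comp ((qcLeftMap _).comp a) =
      (qcLeftMap _).comp ((qcLeftMap (RAlg.leftLinear f)).comp a)
    rw [← qcLeftMap_comp_comp, ← qcLeftMap_comp_comp]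
    congr 2
    exact LinearMap.ext fun t => map_mul f.right.hom t s

/-- The dual `S ↦ Hom(G, 𝒮)` of a functor of right modules, a functor of left modules; here `𝒮` is
the quasi-coherent functor `T ↦ S ⊗_R T` of the right `R`-module `S`. -/
def RightFunctor.dual (G : RightFunctor.{u, v} R) : LeftFunctor.{u, max (u + 1) v} R where
  functor :=
    { obj := fun S => AddCommGrpCat.of (RightFunctor.Hom G (qcRight R S.right))
      map := fun f => AddCommGrpCat.ofHom
        { toFun := fun a => (qcRightMap (RAlg.rightLinear f)).comp a
          map_zero' := RightFunctor.Hom.comp_zero _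
          map_add' := RightFunctor.Hom.comp_add _ }
      map_id := fun _ => AddCommGrpCat.hom_ext (AddMonoidHom.ext fun a => qcRightMap_id_comp a)
      map_comp := fun f g => AddCommGrpCat.hom_ext (AddMonoidHom.ext fun a =>
        qcRightMap_comp_comp (RAlg.rightLinear g) (RAlg.rightLinear f) a) }
  module S := RightFunctor.Hom.instModule G S
  map_smul {S T} f s a := by
    change (qcRightMap (RAlg.rightLinear f)).comp ((qcRightMap _).comp a) =
      (qcRightMap _).comp ((qcRightMap (RAlg.rightLinear f)).comp a)
    rw [← qcRightMap_comp_comp, ← qcRightMap_comp_comp]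
    congr 2
    exact LinearMap.ext fun t => map_mul f.right.hom s t

/-- The natural morphism `F → F^∨∨`: it sends `x ∈ F(S)` to the morphism `F^∨ → 𝒮` with
`F^∨(T) = Hom(F, 𝒯) ∋ a ↦ a_S(x) ∈ 𝒯(S) = S ⊗_R T = 𝒮(T)`. -/
def LeftFunctor.toBidual (F : LeftFunctor.{u, v} R) : LeftFunctor.Hom F F.dual.dual where
  app S :=
    { toFun := fun x =>
        ({ app := fun T =>
            { toFun := fun a : LeftFunctor.Hom F (qcLeft R T.right) => a.app S x
              map_add' := fun _ _ => rfl
              map_smul' := fun _ _ => rfl }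
           naturality := fun _ _ => rfl } : RightFunctor.Hom F.dual (qcRight R S.right))
      map_add' := fun x y => by
        refine RightFunctor.Hom.ext (funext fun T => LinearMap.ext fun a => ?_)
        exact map_add (LeftFunctor.Hom.app a S) x y
      map_smul' := fun s x => by
        refine RightFunctor.Hom.ext (funext fun T => LinearMap.ext fun a => ?_)
        exact _root_.map_smul (LeftFunctor.Hom.app a S) s x }
  naturality f x := by
    refine RightFunctor.Hom.ext (funext fun T => LinearMap.ext fun a => ?_)
    exact LeftFunctor.Hom.naturality a f x

end Dual

end RMod

end

/-! A morphism from the functor of `M` to that of `T` is determined over the initial algebra `R`,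
where it is an `R`-linear map `M → T` (`qcLeftMap_surjective`). So an element `φ` of the bidual at
`S` is a family of maps `Hom_R(M, T) → S ⊗_R T`, natural in `T` and right `T`-linear. It must be
shown to be evaluation at a unique element of `S ⊗_R M`.

A Yoneda argument would evaluate `φ` at the identity of `M`, but `M` is not an algebra. Instead `M`
is placed in the corner of the upper triangular matrix ring with diagonal `(R, R)` and corner `M ⊗_ℤ
R`; the factor `R` supplies the right action that `M` lacks. Let `u : M → alg R M` send `m` to the
corner `m ⊗ 1`. The element sought is obtained from `φ(u)` by projecting to the corner and
contracting `s ⊗ (m ⊗ r) ↦ r s ⊗ m` (`descend`). If `φ` is evaluation at `x`, this returns `x`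
(`descend_unit`).

Conversely, let `f : M → T` be linear. The induced map `alg R M → alg T T` carries `u` to `diag f ·
E`, where `E` has corner `1 ⊗ 1` and zero diagonal. Naturality and right linearity of `φ` then
relate `φ(u)` to `φ(diag f) · E`. Contracting the corner of `z · E` gives the first diagonal entry
of `z` (`descend_mul_elem`), and the first entry of `φ(diag f)` is `φ(f)`, again by naturality. As
contraction commutes with `f` (`descend_map`), `φ(f)` is the image under `id ⊗ f` of the element
found. -/

namespace RMod

/-! ### Morphisms between quasi-coherent functors come from linear maps -/

section

variable {R : Type u} [Ring R]

/-- The homomorphism out of `N ⊗_R M` induced by a balanced biadditive map. -/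
def Tensor.lift {N : Type v} [AddCommGroup N] [Module Rᵐᵒᵖ N] {M : Type w} [AddCommGroup M]
    [Module R M] {A : Type*} [AddCommGroup A] (h : N →+ M →+ A)
    (hb : ∀ n (r : R) m, h (op r • n) m = h n (r • m)) : Tensor R N M →+ A :=
  QuotientAddGroup.lift (tensorRel R N M) (TensorProduct.liftAddHom h (fun r n m => by simp)) (by
    rw [tensorRel, AddSubgroup.closure_le]
    rintro _ ⟨n, r, m, rfl⟩
    change _ = _
    rw [map_sub, TensorProduct.liftAddHom_tmul, TensorProduct.liftAddHom_tmul, hb, sub_self])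

/-- A morphism of functors of left modules which is bijective at every `R`-algebra is an
isomorphism. -/
lemma LeftFunctor.Hom.isIso_of_bijective {F : LeftFunctor.{u, v} R} {G : LeftFunctor.{u, w} R}
    (a : LeftFunctor.Hom F G) (h : ∀ S, Function.Bijective (a.app S)) : a.IsIso := by
  let e := fun S => LinearEquiv.ofBijective (a.app S) (h S)
  refine ⟨⟨fun S => (e S).symm, fun {S T} f x => ?_⟩, ?_, ?_⟩
  · refine (h T).1 ?_
    rw [a.naturality]
    exact ((e T).apply_symm_apply _).trans
      (congrArg (G.functor.map f) ((e S).apply_symm_apply x).symm)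
  · exact LeftFunctor.Hom.ext (funext fun S => LinearMap.ext fun x => (e S).symm_apply_apply x)
  · exact LeftFunctor.Hom.ext (funext fun S => LinearMap.ext fun x => (e S).apply_symm_apply x)

/-- The ring `R`, as an `R`-algebra. -/
def RAlg.base (R : Type u) [Ring R] : RAlg R := Under.mk (𝟙 (RingCat.of R))

/-- The structure morphism from the initial `R`-algebra. -/
def RAlg.fromBase (S : RAlg R) : RAlg.base R ⟶ S := Under.homMk S.hom (by simp [RAlg.base])

lemma RAlg.fromBase_one (S : RAlg R) : (RAlg.fromBase S).right (1 : R) = (1 : S.right) :=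
  map_one S.str

/-- The identification of the underlying ring of the initial `R`-algebra with `R`. -/
def RAlg.baseHom (R : Type u) [Ring R] : (RAlg.base R).right →+* R := RingHom.id R

/-- Multiplication `R ⊗_R M → M`. -/
def Tensor.baseMul (M : Type w) [AddCommGroup M] [Module R M] :
    Tensor R (RAlg.base R).right M →+ M :=
  Tensor.lift ((smulAddHom R M).comp (RAlg.baseHom R).toAddMonoidHom)
    (fun n r m => mul_smul (RAlg.baseHom R n) r m)

/-- Moving the scalar across gives `r ⊗ m = 1 ⊗ r m`. Hence a value over the initial algebra can be
named by a single element of the module. -/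
lemma Tensor.one_tmul_baseMul {M : Type w} [AddCommGroup M] [Module R M]
    (x : Tensor R (RAlg.base R).right M) :
    tmul R (1 : (RAlg.base R).right) (Tensor.baseMul M x) = x := by
  induction x using Tensor.induction with
  | h0 =>
    have h := tmul_add (R := R) (1 : (RAlg.base R).right) (0 : M) 0
    rw [add_zero, left_eq_add] at h
    rw [map_zero, h]
  | ht r m =>
    change tmul R (1 : (RAlg.base R).right) (RAlg.baseHom R r • m) = _
    rw [← smul_tmul]
    congr 1
    exact one_mul (r : R)
  | ha x y hx hy => rw [map_add, tmul_add, hx, hy]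

/-- Every morphism of quasi-coherent functors comes from a morphism of modules. -/
lemma qcLeftMap_surjective {M N : Type v} [AddCommGroup M] [Module R M] [AddCommGroup N]
    [Module R N] : Function.Surjective
      (qcLeftMap : (M →ₗ[R] N) → LeftFunctor.Hom (qcLeft R M) (qcLeft R N)) := by
  intro a
  -- Since `R` is initial and the `1 ⊗ m` generate `S ⊗_R M` over `S`, the values at `1 ⊗ m` over
  -- `R` determine `a` everywhere.
  let g : M → Tensor R (RAlg.base R).right N := fun m =>
    a.app (RAlg.base R) (tmul R (1 : (RAlg.base R).right) m)
  have hsmul : ∀ (r : R) (m : M), g (r • m) =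
      ((qcLeft R N).module (RAlg.base R)).smul (r : R) (g m) := by
    intro r m
    refine Eq.trans ?_ ((a.app (RAlg.base R)).map_smul (r : R) (tmul R (1 : R) m))
    change a.app (RAlg.base R) _ = a.app (RAlg.base R) _
    congr 1
    rw [← smul_tmul]
    change tmul R ((1 : R) * r) m = tmul R (r * 1 : R) m
    rw [one_mul, mul_one]
  have hbase : ∀ (r : R) (x : Tensor R (RAlg.base R).right N), Tensor.baseMul N
      (((qcLeft R N).module (RAlg.base R)).smul (r : R) x) = r • Tensor.baseMul N x := by
    intro r x
    induction x using Tensor.induction with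
    | h0 =>
      have := ((qcLeft R N).module (RAlg.base R)).smul_zero (r : R)
      refine (congrArg (Tensor.baseMul N) this).trans ?_
      rw [map_zero, smul_zero]; rfl
    | ht s m => exact mul_smul r (RAlg.baseHom R s) m
    | ha x y hx hy =>
      have := ((qcLeft R N).module (RAlg.base R)).smul_add (r : R) x y
      refine (congrArg (Tensor.baseMul N) this).trans ?_
      rw [map_add, smul_add, ← hx, ← hy]
      exact map_add _ _ _
  let f : M →ₗ[R] N :=
    { toFun := fun m => Tensor.baseMul N (g m)
      map_add' := fun m m' => by
        have : g (m + m') = g m + g m' :=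
          (congrArg (a.app (RAlg.base R)) (tmul_add (R := R) _ m m')).trans (map_add _ _ _)
        rw [this, map_add]
      map_smul' := fun r m => by rw [hsmul, hbase]; rfl }
  -- Naturality along `R → S` transports the value at `1 ⊗ m` from `R` to `S`.
  have key : ∀ (S : RAlg R) (m : M),
      a.app S (tmul R (1 : S.right) m) = tmul R (1 : S.right) (f m) := by
    intro S m
    have h := a.naturality (RAlg.fromBase S) (tmul R (1 : (RAlg.base R).right) m)
    have h1 : a.app (RAlg.base R) (tmul R (1 : (RAlg.base R).right) m) =
        tmul R (1 : (RAlg.base R).right) (f m) := (Tensor.one_tmul_baseMul _).symm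
    rw [h1] at h
    have e : ∀ {X : Type v} [AddCommGroup X] [Module R X] (x : X),
        (qcLeft R X).functor.map (RAlg.fromBase S) (tmul R (1 : (RAlg.base R).right) x) =
          tmul R (1 : S.right) x := fun x =>
      congrArg (fun s : S.right => tmul R s x) (RAlg.fromBase_one S)
    exact (congrArg (a.app S) (e m).symm).trans (h.trans (e (f m)))
  refine ⟨f, LeftFunctor.Hom.ext (funext fun S => LinearMap.ext fun x => ?_)⟩
  have : ((qcLeftMap f).app S).toAddMonoidHom = (a.app S).toAddMonoidHom := by
    refine Tensor.hom_ext fun s m => ?_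
    -- Writing `s ⊗ x = s (1 ⊗ x)` reduces the comparison to `key` by `S`-linearity.
    have hs : ∀ {X : Type v} [AddCommGroup X] [Module R X] (x : X),
        (tmul R s x : Tensor R S.right X) =
          ((qcLeft R X).module S).smul s (tmul R (1 : S.right) x) := fun x =>
      congrArg (fun s : S.right => tmul R s x) (mul_one s).symm
    refine (hs (f m)).trans ?_
    rw [← key]
    exact ((a.app S).map_smul s _).symm.trans (congrArg (a.app S) (hs m).symm)
  exact DFunLike.congr_fun this x

end

/-! ### The triangular matrix ring -/

/-- The upper triangular matrices with diagonal entries in `A` and `R` and with off-diagonal entry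
in the `(A, R)`-bimodule `X ⊗_ℤ R`. -/
@[ext] structure Triangular (R : Type u) [Ring R] (A X : Type u) [AddCommGroup X] where
  fst : A
  off : X ⊗[ℤ] R
  snd : R

namespace Triangular

section

variable {R : Type u} [Ring R] {A X : Type u} [Ring A] [AddCommGroup X]

/-- The right action of `R` on `X ⊗_ℤ R`. -/
def right (r : R) : X ⊗[ℤ] R →+ X ⊗[ℤ] R :=
  (TensorProduct.map LinearMap.id (AddMonoidHom.mulRight r).toIntLinearMap).toAddMonoidHom

@[simp] lemma right_tmul (x : X) (s r : R) : right r (x ⊗ₜ[ℤ] s) = x ⊗ₜ (s * r) := rfl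

lemma right_one (z : X ⊗[ℤ] R) : right 1 z = z := by
  induction z with
  | zero => simp
  | tmul x r => simp
  | add x y hx hy => rw [map_add, hx, hy]

lemma right_zero (z : X ⊗[ℤ] R) : right 0 z = 0 := by
  induction z with
  | zero => simp
  | tmul x r => simp
  | add x y hx hy => rw [map_add, hx, hy, add_zero]

lemma right_mul (r s : R) (z : X ⊗[ℤ] R) : right (r * s) z = right s (right r z) := by
  induction z with
  | zero => simp
  | tmul x r => simp [mul_assoc]
  | add x y hx hy => rw [map_add, hx, hy, map_add, map_add]

lemma right_add (r s : R) (z : X ⊗[ℤ] R) : right (r + s) z = right r z + right s z := by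
  induction z with
  | zero => simp
  | tmul x r => simp [mul_add, TensorProduct.tmul_add]
  | add x y hx hy => rw [map_add, hx, hy, map_add, map_add]; abel

instance : Zero (Triangular R A X) := ⟨⟨0, 0, 0⟩⟩
instance : One (Triangular R A X) := ⟨⟨1, 0, 1⟩⟩
instance : Add (Triangular R A X) :=
  ⟨fun y z => ⟨y.fst + z.fst, y.off + z.off, y.snd + z.snd⟩⟩
instance : Neg (Triangular R A X) := ⟨fun y => ⟨-y.fst, -y.off, -y.snd⟩⟩
@[simp] lemma zero_def : (0 : Triangular R A X) = ⟨0, 0, 0⟩ := rfl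
@[simp] lemma one_def : (1 : Triangular R A X) = ⟨1, 0, 1⟩ := rfl
@[simp] lemma add_def (y z : Triangular R A X) :
    y + z = ⟨y.fst + z.fst, y.off + z.off, y.snd + z.snd⟩ := rfl
@[simp] lemma neg_def (y : Triangular R A X) : -y = ⟨-y.fst, -y.off, -y.snd⟩ := rfl
variable [Module A X]

/-- The two actions touch different tensor factors; this bimodule law is what makes matrix
multiplication associative. -/
lemma smul_right (a : A) (r : R) (z : X ⊗[ℤ] R) : a • right r z = right r (a • z) := by
  induction z with
  | zero => simp
  | tmul x r => simp [TensorProduct.smul_tmul']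
  | add x y hx hy => simp only [map_add, smul_add, hx, hy]

instance : Mul (Triangular R A X) :=
  ⟨fun y z => ⟨y.fst * z.fst, y.fst • z.off + right z.snd y.off, y.snd * z.snd⟩⟩

@[simp] lemma mul_def (y z : Triangular R A X) :
    y * z = ⟨y.fst * z.fst, y.fst • z.off + right z.snd y.off, y.snd * z.snd⟩ := rfl

instance : Ring (Triangular R A X) where
  add_assoc x y z := by simp [add_assoc]
  zero_add x := by simp
  add_zero x := by simp
  add_comm x y := by simp [add_comm]
  neg_add_cancel x := by simp
  mul_assoc x y z := by
    simp [mul_assoc, smul_add, mul_smul, smul_right, right_mul, add_assoc]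
  one_mul x := by simp
  mul_one x := by simp [right_one]
  zero_mul x := by simp
  mul_zero x := by simp [right_zero]
  left_distrib x y z := by
    simp only [add_def, mul_def, mul_add, smul_add, right_add, mk.injEq, true_and, and_true]
    abel
  right_distrib x y z := by
    simp only [add_def, mul_def, add_mul, add_smul, map_add, mk.injEq, true_and, and_true]
    abel
  nsmul := nsmulRec
  zsmul := zsmulRec

end

/-! ### Triangular algebras over `R` and their distinguished elements and maps -/

section

variable {R : Type u} [Ring R]

/-- The `R`-algebra of upper triangular matrices over an `R`-algebra `S` and an `S`-module `X`. -/
def alg (S : RAlg R) (X : Type u) [AddCommGroup X] [Module S.right X] : RAlg R :=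
  Under.mk (Y := RingCat.of (Triangular R S.right X)) (RingCat.ofHom
    { toFun := fun r => ⟨S.str r, 0, r⟩
      map_one' := by simp
      map_mul' := by simp
      map_zero' := by simp
      map_add' := by simp })

/-- The diagonal entry in `S`, as a morphism of `R`-algebras. -/
def fstHom (S : RAlg R) (X : Type u) [AddCommGroup X] [Module S.right X] : alg S X ⟶ S :=
  Under.homMk (RingCat.ofHom
    { toFun := fun z : Triangular R S.right X => z.fst
      map_one' := rfl
      map_mul' := fun _ _ => rfl
      map_zero' := rfl
      map_add' := fun _ _ => rfl }) rfl

/-- The off-diagonal entry is left `R`-linear. -/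
def offLinear (S : RAlg R) (X : Type u) [AddCommGroup X] [Module S.right X] [Module R X]
    (h : ∀ (r : R) (x : X), S.str r • x = r • x) : (alg S X).right →ₗ[R] X ⊗[ℤ] R where
  toFun := fun z : Triangular R S.right X => z.off
  map_add' _ _ := rfl
  map_smul' r z := by
    let z' : Triangular R S.right X := z
    change S.str r • z'.off + right z'.snd 0 = r • z'.off
    rw [map_zero, add_zero]
    induction z'.off with
    | zero => simp
    | tmul x r => simp only [TensorProduct.smul_tmul', h]
    | add x y hx hy => simp only [smul_add, hx, hy]

/-- Left modules over `R` are modules over the initial `R`-algebra. -/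
instance baseModule (X : Type u) [AddCommGroup X] [Module R X] :
    Module (RAlg.base R).right X := Module.compHom X (RAlg.baseHom R)

/-- The embedding of a left `R`-module `M` in the off-diagonal entries over `R`. -/
def unit (M : Type u) [AddCommGroup M] [Module R M] : M →ₗ[R] (alg (RAlg.base R) M).right where
  toFun m := (⟨0, m ⊗ₜ 1, 0⟩ : Triangular R (RAlg.base R).right M)
  map_add' m m' := by
    refine Triangular.ext (add_zero _).symm (TensorProduct.add_tmul m m' 1) (add_zero _).symm
  map_smul' r m := by
    refine Triangular.ext (mul_zero _).symm ?_ (mul_zero _).symm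
    change (r • m) ⊗ₜ 1 = (r • m) ⊗ₜ 1 + right 0 0
    rw [map_zero, add_zero]

/-- A linear map with values in the first diagonal entry. -/
def diag {M : Type u} [AddCommGroup M] [Module R M] (T : RAlg R) (f : M →ₗ[R] T.right) :
    M →ₗ[R] (alg T T.right).right where
  toFun m := (⟨f m, 0, 0⟩ : Triangular R T.right T.right)
  map_add' m m' := Triangular.ext (map_add f m m') (add_zero _).symm (add_zero _).symm
  map_smul' r m := by
    refine Triangular.ext (map_smul f r m) ?_ (mul_zero _).symm
    change 0 = T.str r • 0 + right 0 0
    rw [map_zero, add_zero, smul_zero]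

/-- The elementary matrix with off-diagonal entry `1 ⊗ 1`. -/
def elem (T : RAlg R) : (alg T T.right).right :=
  (⟨0, 1 ⊗ₜ 1, 0⟩ : Triangular R T.right T.right)

/-- Functoriality of the algebra of triangular matrices. -/
def map {M : Type u} [AddCommGroup M] [Module R M] (T : RAlg R) (f : M →ₗ[R] T.right) :
    alg (RAlg.base R) M ⟶ alg T T.right :=
  Under.homMk (RingCat.ofHom
    { toFun := fun z : Triangular R (RAlg.base R).right M =>
        (⟨T.str (RAlg.baseHom R z.fst),
          TensorProduct.map f.toAddMonoidHom.toIntLinearMap LinearMap.id z.off, z.snd⟩ :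
            Triangular R T.right T.right)
      map_one' := by simp
      map_mul' := fun y z => by
        refine Triangular.ext ?_ ?_ rfl
        · simp
        · have h1 : ∀ (a : (RAlg.base R).right) (w : M ⊗[ℤ] R),
              TensorProduct.map f.toAddMonoidHom.toIntLinearMap LinearMap.id (a • w) =
                T.str (RAlg.baseHom R a) •
                  TensorProduct.map f.toAddMonoidHom.toIntLinearMap LinearMap.id w := by
            intro a w
            induction w with
            | zero => simp
            | tmul m r =>
              exact congrArg (· ⊗ₜ[ℤ] r) (map_smul f (RAlg.baseHom R a) m)
            | add x y hx hy => simp only [smul_add, map_add, hx, hy]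
          have h2 : ∀ (r : R) (w : M ⊗[ℤ] R),
              TensorProduct.map f.toAddMonoidHom.toIntLinearMap LinearMap.id (right r w) =
                right r (TensorProduct.map f.toAddMonoidHom.toIntLinearMap LinearMap.id w) := by
            intro r w
            induction w with
            | zero => simp
            | tmul m s => rfl
            | add x y hx hy => simp only [map_add, hx, hy]
          simp only [mul_def, map_add, h1, h2]
      map_zero' := by simp
      map_add' := by simp }) (RingCat.hom_ext (RingHom.ext fun r =>
        Triangular.ext rfl (map_zero (TensorProduct.map _ _)) rfl))

/-! ### Contracting the off-diagonal entry -/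

/-- For fixed `s`, the homomorphism `x ⊗ r ↦ r s ⊗ x`. -/
def contractAt (S : RAlg R) (X : Type u) [AddCommGroup X] [Module R X] (s : S.right) :
    X ⊗[ℤ] R →+ Tensor R S.right X :=
  TensorProduct.liftAddHom
    (AddMonoidHom.mk' (fun x => AddMonoidHom.mk' (fun r : R => tmul R (r • s) x)
        (fun r r' => by rw [add_smul, add_tmul]))
      (fun x x' => AddMonoidHom.ext fun r => tmul_add _ _ _))
    (fun n x r => by simp only [map_zsmul]; rfl)

lemma contractAt_tmul (S : RAlg R) {X : Type u} [AddCommGroup X] [Module R X] (s : S.right)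
    (x : X) (r : R) : contractAt S X s (x ⊗ₜ[ℤ] r) = tmul R (r • s) x := rfl

lemma contractAt_add (S : RAlg R) {X : Type u} [AddCommGroup X] [Module R X] (s s' : S.right) :
    contractAt S X (s + s') = contractAt S X s + contractAt S X s' := by
  ext z
  induction z with
  | zero => simp
  | tmul x r =>
    rw [AddMonoidHom.add_apply]
    simp only [contractAt_tmul, smul_add, add_tmul]
  | add x y hx hy => rw [map_add, hx, hy, map_add]

/-- Since `r (s a) = (r s) a` in `S`, the scalar `a` can cross to `x`. Letting `r` act on `s` from
the left is what makes the contraction balanced without a right action on `X`. -/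
lemma contractAt_smul (S : RAlg R) {X : Type u} [AddCommGroup X] [Module R X] (s : S.right)
    (a : R) (z : X ⊗[ℤ] R) : contractAt S X (op a • s) z = contractAt S X s (a • z) := by
  induction z with
  | zero => simp
  | tmul x r =>
    rw [TensorProduct.smul_tmul', contractAt_tmul, contractAt_tmul, ← smul_tmul]
    congr 1
    simp only [RAlg.smul_def, RAlg.op_smul_def, mul_assoc]
  | add x y hx hy => rw [smul_add, map_add, map_add, hx, hy]

/-- The homomorphism `s ⊗ (x ⊗ r) ↦ r s ⊗ x`. -/
def contract (S : RAlg R) (X : Type u) [AddCommGroup X] [Module R X] :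
    Tensor R S.right (X ⊗[ℤ] R) →+ Tensor R S.right X :=
  Tensor.lift (AddMonoidHom.mk' (contractAt S X) (contractAt_add S)) (contractAt_smul S)

lemma map_contractAt (S : RAlg R) {X Y : Type u} [AddCommGroup X] [Module R X] [AddCommGroup Y]
    [Module R Y] (f : X →ₗ[R] Y) (s : S.right) (z : X ⊗[ℤ] R) :
    Tensor.map LinearMap.id f (contractAt S X s z) = contractAt S Y s
      (TensorProduct.map f.toAddMonoidHom.toIntLinearMap LinearMap.id z) := by
  induction z with
  | zero => simp
  | tmul x r => rfl
  | add x y hx hy => simp only [map_add, hx, hy]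

/-- The off-diagonal part of `S ⊗_R (alg B X)`, contracted to `S ⊗_R X`. -/
def descend (S : RAlg R) (X : Type u) [AddCommGroup X] [Module R X] (B : RAlg R)
    [Module B.right X] (h : ∀ (r : R) (x : X), B.str r • x = r • x) :
    Tensor R S.right (alg B X).right →+ Tensor R S.right X :=
  (contract S X).comp (Tensor.map LinearMap.id (offLinear B X h))

/-- The corner of `unit M m` is `m ⊗ 1`, and its factor `1` acts trivially on `s`. -/
lemma descend_unit (S : RAlg R) {M : Type u} [AddCommGroup M] [Module R M]
    (h : ∀ (r : R) (x : M), (RAlg.base R).str r • x = r • x) (x : Tensor R S.right M) :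
    descend S M (RAlg.base R) h (Tensor.map LinearMap.id (unit M) x) = x := by
  have : (descend S M (RAlg.base R) h).comp (Tensor.map LinearMap.id (unit M)) =
      AddMonoidHom.id _ := Tensor.hom_ext fun s m =>
    congrArg (fun s : S.right => tmul R s m) (one_smul R s)
  exact DFunLike.congr_fun this x

/-- On corners the algebra map is `f ⊗ id`, while the contraction uses only the factor `R` and `s`,
so the two commute. -/
lemma descend_map (S T : RAlg R) {M : Type u} [AddCommGroup M] [Module R M]
    (h : ∀ (r : R) (x : M), (RAlg.base R).str r • x = r • x)
    (h' : ∀ (r : R) (x : T.right), T.str r • x = r • x) (f : M →ₗ[R] T.right)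
    (z : Tensor R S.right (alg (RAlg.base R) M).right) :
    descend S T.right T h' (Tensor.map LinearMap.id (RAlg.leftLinear (Triangular.map T f)) z) =
      Tensor.map LinearMap.id f (descend S M (RAlg.base R) h z) := by
  have : (descend S T.right T h').comp
      (Tensor.map LinearMap.id (RAlg.leftLinear (Triangular.map T f))) =
      (Tensor.map LinearMap.id f).comp (descend S M (RAlg.base R) h) :=
    Tensor.hom_ext fun s (z : Triangular R (RAlg.base R).right M) =>
      (map_contractAt S f s z.off).symm
  exact DFunLike.congr_fun this z

/-- Right multiplication by the elementary matrix moves the first diagonal entry `t` to the corner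
as `t ⊗ 1` and, its lower diagonal entry being `0`, erases the old corner. -/
lemma descend_mul_elem (S T : RAlg R) (h : ∀ (r : R) (x : T.right), T.str r • x = r • x)
    (z : Tensor R S.right (alg T T.right).right) :
    descend S T.right T h
        (Tensor.map LinearMap.id (Module.toModuleEnd R _ (op (elem T))) z) =
      Tensor.map LinearMap.id (RAlg.leftLinear (fstHom T T.right)) z := by
  have : (descend S T.right T h).comp
      (Tensor.map LinearMap.id (Module.toModuleEnd R _ (op (elem T)))) =
      Tensor.map LinearMap.id (RAlg.leftLinear (fstHom T T.right)) := by
    refine Tensor.hom_ext fun s (z : Triangular R T.right T.right) => ?_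
    change contractAt S T.right s ((z.fst * 1) ⊗ₜ 1 + right 0 z.off) = tmul R s z.fst
    rw [right_zero, add_zero, mul_one, contractAt_tmul, one_smul]
  exact DFunLike.congr_fun this z

end

end Triangular

/-! ### The inverse of the biduality morphism -/

section

variable {R : Type u} [Ring R] {M : Type u} [AddCommGroup M] [Module R M]

open Triangular

lemma toBidual_bijective (S : RAlg R) :
    Function.Bijective ((LeftFunctor.toBidual (qcLeft R M)).app S) := by
  let d := descend S M (RAlg.base R) (fun _ _ => rfl)
  -- The candidate inverse evaluates `φ` at the universal map `unit M` and contracts the corner.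
  let φ₀ : RightFunctor.Hom (qcLeft R M).dual (qcRight R S.right) → Tensor R S.right M :=
    fun φ => d (φ.app (alg (RAlg.base R) M) (qcLeftMap (unit M)))
  have hl : ∀ x, φ₀ ((LeftFunctor.toBidual (qcLeft R M)).app S x) = x :=
    fun x => descend_unit S _ x
  have hr : ∀ (φ : RightFunctor.Hom (qcLeft R M).dual (qcRight R S.right)),
      (LeftFunctor.toBidual (qcLeft R M)).app S (φ₀ φ) = φ := by
    intro φ
    refine RightFunctor.Hom.ext (funext fun T => LinearMap.ext fun a => ?_)
    obtain ⟨f, rfl⟩ := qcLeftMap_surjective a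
    -- The universal map is carried to `diag T f` times the elementary matrix.
    have e1 : (qcLeft R M).dual.functor.map (Triangular.map T f) (qcLeftMap (unit M)) =
        ((qcLeft R M).dual.module (alg T T.right)).smul (op (elem T))
          (qcLeftMap (diag T f)) := by
      change (qcLeftMap (RAlg.leftLinear (Triangular.map T f))).comp (qcLeftMap (unit M)) =
        (qcLeftMap (Module.toModuleEnd R (alg T T.right).right (op (elem T)))).comp
          (qcLeftMap (diag T f))
      refine LeftFunctor.Hom.ext (funext fun U => LinearMap.ext fun x => ?_)
      refine Tensor.map_map_eq (fun _ => rfl) (fun m => ?_) x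
      refine Triangular.ext ?_ ?_ ?_
      · change T.str 0 = f m * 0
        rw [map_zero, mul_zero]
      · change f m ⊗ₜ[ℤ] (1 : R) = (f m * 1) ⊗ₜ[ℤ] (1 : R) + right 0 0
        rw [map_zero, add_zero, mul_one]
      · exact (mul_zero _).symm
    -- `diag T f` is a lift of `f` through the projection to the first diagonal entry; only its
    -- `R`-linearity is needed.
    have e2 : (qcLeft R M).dual.functor.map (fstHom T T.right) (qcLeftMap (diag T f)) =
        qcLeftMap f := by
      refine LeftFunctor.Hom.ext (funext fun U => LinearMap.ext fun x => ?_)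
      exact Tensor.map_map LinearMap.id (RAlg.leftLinear (fstHom T T.right)) LinearMap.id
        (diag T f) x
    have n1 := φ.naturality (Triangular.map T f) (qcLeftMap (unit M))
    have n2 := φ.naturality (fstHom T T.right) (qcLeftMap (diag T f))
    have n3 := (φ.app (alg T T.right)).map_smul (op (elem T)) (qcLeftMap (diag T f))
    rw [e1] at n1
    rw [e2] at n2
    change Tensor.map LinearMap.id f (d _) = _
    -- The chain is `(id ⊗ f)(d φ(u)) = descend (φ(diag f) · E) = fst φ(diag f) = φ(f)`, with `u`
    -- the universal map and `E` the elementary matrix.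
    refine (descend_map S T _ (fun _ _ => rfl) f _).symm.trans ?_
    refine (congrArg (descend S T.right T _) (n1.symm.trans n3)).trans ?_
    exact (descend_mul_elem S T _ _).trans n2.symm
  exact ⟨Function.LeftInverse.injective hl, Function.RightInverse.surjective hr⟩

end

end RMod

theorem theorem5p3 (R : Type u) [Ring R] (M : Type u) [AddCommGroup M] [Module R M] :
    (RMod.LeftFunctor.toBidual (RMod.qcLeft R M)).IsIso :=
  RMod.LeftFunctor.Hom.isIso_of_bijective _ RMod.toBidual_bijective
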